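/- For positive integers $q\le p$, let $K_{p/q}$ be the Kneser graph: its vertices are the $q$-element subsets of $\{1,\dots,p\}$, and two vertices are adjacent if and only if they are disjoint. For real $k>0$, a fractional $k$-coloring of a graph $G$ is a map $c$ assigning to each vertex of $G$ a Lebesgue measurable subset of $[0,k)$ of measure one such that adjacent vertices receive disjoint sets. Let $\varepsilon\ge 0$ be a real number, let $p$ and $q$ be positive integers with $p/q\ge 2$, and let $c$ be any fractional $(p/q+\varepsilon)$-coloring of $K_{p/q}$. Then there is a vertex $v$ of $K_{p/q}$ such that $$\Bigl\|\bigcup_{u\in N(v)}c(u)\Bigr\|\ \ge\ \frac pq-1,$$ where $N(v)$ is the set of neighbors of $v$ and $\|\cdot\|$ denotes Lebesgue measure. -/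

import Mathlib

open MeasureTheory

/-- The Kneser graph `K_{p/q}`: its vertices are the `q`-element subsets of a `p`-element set,
and two vertices are adjacent when they are disjoint. The clause `A ≠ B` matters only for `q = 0`,
where it removes the loop at the empty set. -/
def kneserGraph (p q : ℕ) : SimpleGraph {A : Finset (Fin p) // A.card = q} where
  Adj A B := A ≠ B ∧ Disjoint A.1 B.1
  symm := ⟨fun _ _ h => ⟨h.1.symm, h.2.symm⟩⟩
  loopless := ⟨fun _ h => h.1 rfl⟩

/-- For positive `q`, adjacency in the Kneser graph is exactly disjointness. -/
theorem kneserGraph_adj_iff {p q : ℕ} (hq : 0 < q) (A B : {A : Finset (Fin p) // A.card = q}) :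
    (kneserGraph p q).Adj A B ↔ Disjoint A.1 B.1 := by
  refine ⟨fun h => h.2, fun h => ⟨?_, h⟩⟩
  rintro rfl
  have h0 : A.1 = ∅ := by simpa using h
  have h1 := A.2
  rw [h0, Finset.card_empty] at h1
  omega

/-- A fractional `k`-coloring of a graph: every vertex receives a Lebesgue measurable subset of
`[0, k)` of measure one, and adjacent vertices receive disjoint subsets. (Lebesgue measurability
is null-measurability for `volume`; Borel sets are a special case.) -/
structure IsFractionalColoring {V : Type*} (G : SimpleGraph V) (k : ℝ) (c : V → Set ℝ) : Prop where
  measurable : ∀ v, NullMeasurableSet (c v) volume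
  subset_Ico : ∀ v, c v ⊆ Set.Ico 0 k
  volume_eq_one : ∀ v, volume (c v) = 1
  disjoint_of_adj : ∀ u v, G.Adj u v → Disjoint (c u) (c v)

/-! The bound already holds on average over the `p` cyclic arcs of length `q`. Fix a point `x` and
let `S` be the set of arcs whose colour contains `x`. Arcs shifted by `q, …, p - q` are disjoint, so
`S` misses its sumset with this interval, and every arc in the sumset has `x` in its neighbourhood's
colours. Sumset growth gives `mul_card_le_mul_card_addInterval`; `mul_sum_measure_le` integrates it
over `x`. -/

open Finset in
/-- A nonempty subset of `ZMod p` closed under adding one is everything. -/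
theorem ZMod.eq_univ_of_add_one_mem {p : ℕ} [NeZero p] {T : Finset (ZMod p)} (hT : T.Nonempty)
    (h : ∀ i ∈ T, i + 1 ∈ T) : T = univ := by
  obtain ⟨a, ha⟩ := hT
  have key : ∀ n : ℕ, a + n ∈ T := by
    intro n
    induction n with
    | zero => simpa using ha
    | succ n ih =>
      have := h _ ih
      rwa [add_assoc, ← Nat.cast_succ] at this
  refine eq_univ_of_forall fun b => ?_
  have := key (b - a).val
  rwa [ZMod.natCast_zmod_val, add_sub_cancel] at this

open Finset in
/-- The sumset of `S` with the interval `{a, …, a + m}` of `ZMod p`. -/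
def addInterval {p : ℕ} (S : Finset (ZMod p)) (a m : ℕ) : Finset (ZMod p) :=
  (S ×ˢ range (m + 1)).image fun x => x.1 + ((a + x.2 : ℕ) : ZMod p)

theorem mem_addInterval {p : ℕ} {S : Finset (ZMod p)} {a m : ℕ} {j : ZMod p} :
    j ∈ addInterval S a m ↔ ∃ i ∈ S, ∃ t ≤ m, i + ((a + t : ℕ) : ZMod p) = j := by
  simp only [addInterval, Finset.mem_image, Finset.mem_product, Finset.mem_range, Prod.exists,
    Nat.lt_succ_iff]
  constructor
  · rintro ⟨i, t, ⟨hi, ht⟩, h⟩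
    exact ⟨i, hi, t, ht, h⟩
  · rintro ⟨i, hi, t, ht, h⟩
    exact ⟨i, t, ⟨hi, ht⟩, h⟩

-- Lengthening the interval by one adds the translate by `1` of the sumset; this is a new element
-- unless the sumset is closed under `+ 1`, hence everything.
open Finset in
theorem card_addInterval {p : ℕ} [NeZero p] {S : Finset (ZMod p)} (hS : S.Nonempty) (a m : ℕ) :
    addInterval S a m = univ ∨ #S + m ≤ #(addInterval S a m) := by
  induction m with
  | zero =>
    right
    rw [add_zero]
    refine card_le_card_of_injOn (fun i => i + ((a + 0 : ℕ) : ZMod p)) ?_ ?_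
    · intro i hi
      exact mem_addInterval.2 ⟨i, hi, 0, le_rfl, rfl⟩
    · intro i _ j _ h
      exact add_right_cancel h
  | succ m ih =>
    have hsub : addInterval S a m ⊆ addInterval S a (m + 1) := by
      intro j hj
      obtain ⟨i, hi, t, ht, rfl⟩ := mem_addInterval.1 hj
      exact mem_addInterval.2 ⟨i, hi, t, by omega, rfl⟩
    have hstep : ∀ j ∈ addInterval S a m, j + 1 ∈ addInterval S a (m + 1) := by
      intro j hj
      obtain ⟨i, hi, t, ht, rfl⟩ := mem_addInterval.1 hj
      refine mem_addInterval.2 ⟨i, hi, t + 1, by omega, ?_⟩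
      push_cast
      ring
    have hne : (addInterval S a m).Nonempty := by
      obtain ⟨i, hi⟩ := hS
      exact ⟨_, mem_addInterval.2 ⟨i, hi, 0, Nat.zero_le _, rfl⟩⟩
    by_cases hc : ∀ j ∈ addInterval S a m, j + 1 ∈ addInterval S a m
    · left
      rw [ZMod.eq_univ_of_add_one_mem hne hc] at hsub
      exact univ_subset_iff.1 hsub
    · right
      push Not at hc
      obtain ⟨j, hj, hj'⟩ := hc
      have hlt := card_lt_card ((ssubset_iff_of_subset hsub).2 ⟨j + 1, hstep j hj, hj'⟩)
      rcases ih with h | h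
      · exact absurd (h ▸ mem_univ (j + 1)) hj'
      · omega

open Finset in
/-- Expansion of independent sets in the circular clique: the vertices `i` and `i + q + t`,
`t ≤ p - 2q`, are adjacent. -/
theorem mul_card_le_mul_card_addInterval {p q : ℕ} [NeZero p] (hpq : 2 * q ≤ p)
    {S : Finset (ZMod p)} (hS : Disjoint S (addInterval S q (p - 2 * q))) :
    (p - q) * #S ≤ q * #(addInterval S q (p - 2 * q)) := by
  rcases S.eq_empty_or_nonempty with rfl | hne
  · simp
  rcases card_addInterval hne q (p - 2 * q) with h | h
  · rw [h] at hS
    obtain ⟨i, hi⟩ := hne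
    exact absurd (mem_univ i) (disjoint_left.1 hS hi)
  · have hcard : #S + #(addInterval S q (p - 2 * q)) ≤ p := by
      rw [← card_union_of_disjoint hS]
      exact (card_le_univ _).trans_eq (ZMod.card p)
    obtain ⟨d, rfl⟩ := Nat.exists_eq_add_of_le hpq
    have e1 : 2 * q + d - q = q + d := by omega
    have e2 : 2 * q + d - 2 * q = d := by omega
    rw [e1]
    rw [e2] at h hcard ⊢
    -- With `p = 2q + d`, `h` and `hcard` give `2 * #S + d ≤ 2q + d`. The goal then follows from `(q
    -- + d) * #S ≤ q * (#S + d)`, that is, `d * #S ≤ d * q`.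
    have hSq : #S ≤ q := by omega
    nlinarith [Nat.mul_le_mul_right d hSq, Nat.mul_le_mul_left q h]

/-- The arc `{i, …, i + q - 1}` of `ZMod p`. -/
def arc (p q : ℕ) (i : ZMod p) : Finset (ZMod p) :=
  (Finset.range q).image fun a : ℕ => i + (a : ZMod p)

theorem card_arc {p q : ℕ} (hqp : q ≤ p) (i : ZMod p) : (arc p q i).card = q := by
  rw [arc, Finset.card_image_of_injOn, Finset.card_range]
  intro a ha b hb h
  have ha' : a < q := by simpa using ha
  have hb' : b < q := by simpa using hb
  have := (ZMod.natCast_eq_natCast_iff' a b p).1 (add_left_cancel h)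
  rwa [Nat.mod_eq_of_lt (by omega), Nat.mod_eq_of_lt (by omega)] at this

theorem disjoint_arc {p q t : ℕ} (hpq : 2 * q ≤ p) (ht : t ≤ p - 2 * q) (i : ZMod p) :
    Disjoint (arc p q i) (arc p q (i + ((q + t : ℕ) : ZMod p))) := by
  rw [Finset.disjoint_left]
  intro x hx hy
  simp only [arc, Finset.mem_image, Finset.mem_range] at hx hy
  obtain ⟨a, ha, rfl⟩ := hx
  obtain ⟨b, hb, h⟩ := hy
  rw [add_assoc, ← Nat.cast_add] at h
  have := (ZMod.natCast_eq_natCast_iff' _ _ p).1 (add_left_cancel h)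
  -- No wrap-around: `q + t + b ≤ p - q + b < p`.
  rw [Nat.mod_eq_of_lt (by omega), Nat.mod_eq_of_lt (by omega)] at this
  omega

open Classical in
/-- A pointwise inequality between multiplicities integrates to an inequality between measures. -/
theorem mul_sum_measure_le {α ι : Type*} [Fintype ι] [MeasurableSpace α] {μ : Measure α}
    {s t : ι → Set α} (hs : ∀ i, NullMeasurableSet (s i) μ) (ht : ∀ i, NullMeasurableSet (t i) μ)
    {a b : ℕ} (h : ∀ x, a * (Finset.univ.filter fun i => x ∈ s i).card
      ≤ b * (Finset.univ.filter fun i => x ∈ t i).card) :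
    (a : ENNReal) * ∑ i, μ (s i) ≤ b * ∑ i, μ (t i) := by
  have key : ∀ {r : ι → Set α}, (∀ i, NullMeasurableSet (r i) μ) → ∀ n : ℕ,
      (n : ENNReal) * ∑ i, μ (r i)
        = ∫⁻ x, ((n * (Finset.univ.filter fun i => x ∈ r i).card : ℕ) : ENNReal) ∂μ := by
    intro r hr n
    have e : ∀ x, ((n * (Finset.univ.filter fun i => x ∈ r i).card : ℕ) : ENNReal)
        = n * ∑ i, (r i).indicator (fun _ => 1) x := by
      intro x
      simp [Set.indicator_apply]
    simp_rw [e]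
    rw [lintegral_const_mul' _ _ (ENNReal.natCast_ne_top n), lintegral_finsetSum' _
      fun i _ => (aemeasurable_const (b := (1 : ENNReal))).indicator₀ (hr i)]
    congr 1
    exact Finset.sum_congr rfl fun i _ => (lintegral_indicator_one₀ (hr i)).symm
  rw [key hs, key ht]
  exact lintegral_mono fun x => Nat.cast_le.2 (h x)

theorem mainTheorem12 (ε : ℝ) (hε : 0 ≤ ε) (p q : ℕ) (hp : 0 < p) (hq : 0 < q)
    (hpq : 2 ≤ (p : ℝ) / (q : ℝ))
    (c : {A : Finset (Fin p) // A.card = q} → Set ℝ)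
    (hc : IsFractionalColoring (kneserGraph p q) ((p : ℝ) / (q : ℝ) + ε) c) :
    ∃ v : {A : Finset (Fin p) // A.card = q},
      (p : ℝ) / (q : ℝ) - 1 ≤ volume.real (⋃ u ∈ (kneserGraph p q).neighborSet v, c u) := by
  classical
  have : NeZero p := ⟨hp.ne'⟩
  have hq' : (0 : ℝ) < q := Nat.cast_pos.2 hq
  have hpq' : 2 * q ≤ p := by
    rw [le_div_iff₀ hq'] at hpq
    exact_mod_cast hpq
  let e : ZMod p ≃ Fin p := (ZMod.finEquiv p).symm.toEquiv
  let v : ZMod p → {A : Finset (Fin p) // A.card = q} := fun i =>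
    ⟨(arc p q i).map e.toEmbedding, by rw [Finset.card_map, card_arc (by omega)]⟩
  have hadj : ∀ (i : ZMod p) (t : ℕ), t ≤ p - 2 * q →
      (kneserGraph p q).Adj (v i) (v (i + ((q + t : ℕ) : ZMod p))) := fun i t ht =>
    (kneserGraph_adj_iff hq _ _).2 ((Finset.disjoint_map _).2 (disjoint_arc hpq' ht i))
  let N : ZMod p → Set ℝ := fun j => ⋃ u ∈ (kneserGraph p q).neighborSet (v j), c u
  have hN : ∀ j, NullMeasurableSet (N j) volume := fun j =>
    NullMeasurableSet.biUnion (Set.to_countable _) fun u _ => hc.measurable u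
  have hNfin : ∀ j, volume (N j) ≠ ⊤ := fun j =>
    measure_ne_top_of_subset (Set.iUnion₂_subset fun u _ => hc.subset_Ico u)
      (by rw [Real.volume_Ico]; exact ENNReal.ofReal_ne_top)
  have hmain := mul_sum_measure_le (μ := volume) (s := fun i => c (v i)) (t := N)
    (fun i => hc.measurable _) hN (a := p - q) (b := q) (by
      intro x
      refine (mul_card_le_mul_card_addInterval hpq' ?_).trans
        (Nat.mul_le_mul_left q (Finset.card_le_card ?_))
      · rw [Finset.disjoint_left]
        intro j hj hj'
        obtain ⟨i, hi, t, ht, rfl⟩ := mem_addInterval.1 hj'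
        exact Set.disjoint_left.1 (hc.disjoint_of_adj _ _ (hadj i t ht))
          (Finset.mem_filter.1 hi).2 (Finset.mem_filter.1 hj).2
      · intro j hj
        obtain ⟨i, hi, t, ht, rfl⟩ := mem_addInterval.1 hj
        exact Finset.mem_filter.2 ⟨Finset.mem_univ _,
          Set.mem_biUnion (hadj i t ht).symm (Finset.mem_filter.1 hi).2⟩)
  simp only [hc.volume_eq_one, Finset.sum_const, Finset.card_univ, ZMod.card, nsmul_eq_mul,
    mul_one] at hmain
  have hreal : ((p : ℝ) - q) * p ≤ q * ∑ j, volume.real (N j) := by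
    have := ENNReal.toReal_mono (ENNReal.mul_ne_top (ENNReal.natCast_ne_top q)
      (ENNReal.sum_ne_top.2 fun j _ => hNfin j)) hmain
    rw [ENNReal.toReal_mul, ENNReal.toReal_mul, ENNReal.toReal_sum fun j _ => hNfin j] at this
    simpa only [ENNReal.toReal_natCast, Nat.cast_sub (show q ≤ p by omega), measureReal_def]
      using this
  -- Divide by `q`: the measures of the `p` sets `N j` average at least `(p - q) / q`.
  have hsum : ∑ _j : ZMod p, ((p : ℝ) / q - 1) ≤ ∑ j, volume.real (N j) := by
    rw [Finset.sum_const, Finset.card_univ, ZMod.card, nsmul_eq_mul]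
    refine le_of_mul_le_mul_left (le_of_eq_of_le ?_ hreal) hq'
    field_simp
  obtain ⟨j, _, hj⟩ := Finset.exists_le_of_sum_le Finset.univ_nonempty hsum
  exact ⟨v j, hj⟩
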